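/- **Setting.** An arena consists of a set $M$ of moves, an enabling relation $\vdash$ on $M$, a labelling $\lambda:M\to\{P,O\}$ with $\lambda(m)\neq\lambda(n)$ whenever $m\vdash n$, and a set $I\ni *$ of initial moves, all labelled $O$. For a player $p\in\{P,O\}$, $\overline p$ is the other player. A *justified sequence* $s=s_0s_1\ldots s_l$ is a finite sequence of moves with $s_0\in I$ in which every $s_i$, $i>0$, points to an earlier move $s_j$, $j<i$, with $s_j\vdash s_i$; the pair $e_i=(s_j,s_i)$ is the edge from $s_i$. It is a *play* if $\lambda(s_i)\ne\lambda(s_{i+1})$ for all $i<l$. Its initial segments are the sequences $s_0\ldots s_i$, $0\le i\le l$. The *$p$-view* of a sequence is defined recursively: the view of the empty sequence is empty; the view of $s\,m$ with $\lambda(m)=p$ is the view of $s$ followed by $m$; the view of $s\,m'\,s'\,m$ with $\lambda(m)=\overline p$ and $m$ pointing to $m'$ is the view of $s$ followed by $m'\,m$; the view of a single initial move is that move. A play is *visible* if each $s_i$, $i>0$, points to a move in the $\lambda(s_i)$-view of $s_0\ldots s_{i-1}$. The edge $(s_{m_1},s_{n_1})$ *crosses* the edge $(s_{m_2},s_{n_2})$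 if $m_2<m_1<n_2<n_1$. By backward induction, an edge $e_i$ of $s_0\ldots s_n$ is *active* in $s_0\ldots s_n$ if every $e_j$ with $i<j\le n$ that crosses $e_i$ is inactive (not active). We write $e_i\dashv e_j$ in $s$ if $e_j$ crosses $e_i$ and $e_i$ is active in $s_0\ldots s_{j-1}$. The *backtracking level* of $s_i$ in $s$ is $0$ if $i=0$ or $s_i$ points to $s_{i-1}$, and otherwise $k+1$, where $k$ is the length of the longest chain of edges $e^1\dashv e^2\dashv\cdots\dashv e^k\dashv e_i$ in $s$. The level of a player $p$ in $s$ is the maximum of the levels of the moves of $p$ in $s$ ($0$ if there are none). The *real backtracking level* of $s$ is the minimum of the levels of $P$ and $O$ in $s$; the *principal player* is $P$ if this minimum is the level of $P$, and $O$ otherwise. For $a>0$, $n\in\mathbb N$ and real $m$ let $a_0^m=m$ and $a_{n+1}^m=a^{a_n^m}$; $\log$ is the logarithm to base $2$. **Theorem (Abstract Min-Backtracking Theorem).** Let $s=s_0s_1\ldots s_l$ be a visible play of real backtracking level $b$, let $p$ be the principal player of $s$, and let $k$ be the length of the longest $p$-view or $\overline p$-view of an initial segment of $s$. Then $$l\ \le\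 k_b^{k}=\underbrace{k^{k^{\cdot^{\cdot^{k}}}}}_{b+1}\qquad\text{and}\qquad l\ \le\ 2_b^{2k\log k},$$ and, if $l\ge 1$ (equivalently $k\ge 2$), moreover $k_b^{k}\le 2_b^{2k\log k}$. -/

import Mathlib

/-- The two players of the game: Player (`P`) and Opponent (`O`). -/
inductive Player where
  | P : Player
  | O : Player
deriving DecidableEq

/-- The adversary of a player. -/
def Player.other : Player → Player
  | .P => .O
  | .O => .P

/-- An arena: a graph of moves with a polarity `label` that alternates along the enabling relation,
and a set of initial moves, all of them Opponent moves, with a distinguished element `star`. -/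
structure Arena where
  /-- moves -/
  Move : Type*
  /-- `enables m n`: the move `m` justifies the move `n` -/
  enables : Move → Move → Prop
  /-- the polarity of a move -/
  label : Move → Player
  label_ne : ∀ m n, enables m n → label m ≠ label n
  /-- initial moves -/
  init : Set Move
  label_init : ∀ m ∈ init, label m = Player.O
  /-- the distinguished initial move -/
  star : Move
  star_mem : star ∈ init

/-- A justified sequence `s₀ s₁ … s_last` over an arena. Only the values `move i` with `i ≤ last` and
`ptr i` with `0 < i ≤ last` are meaningful; `ptr i` is the position of the move that `s_i` points
to. Moves are always referred to by their positions (occurrences) in the sequence. -/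
structure JustifiedSeq (A : Arena) where
  last : ℕ
  move : ℕ → A.Move
  ptr : ℕ → ℕ
  move_zero : move 0 ∈ A.init
  ptr_lt : ∀ i, 0 < i → i ≤ last → ptr i < i
  enables_ptr : ∀ i, 0 < i → i ≤ last → A.enables (move (ptr i)) (move i)

namespace JustifiedSeq

variable {A : Arena}

/-- The owner `λ(s_i)` of the move at position `i`. -/
def owner (s : JustifiedSeq A) (i : ℕ) : Player := A.label (s.move i)

/-- A play is a justified sequence in which the players alternate. -/
def IsPlay (s : JustifiedSeq A) : Prop :=
  ∀ i, i < s.last → s.owner i ≠ s.owner (i + 1)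

/-- `s.view p n` is the `p`-view of the initial segment `s₀ … s_{n-1}` consisting of the first `n`
moves, as the list of the positions of its moves. The last branch is reached only by the initial
move, at position `0`. -/
def view (s : JustifiedSeq A) (p : Player) : ℕ → List ℕ
  | 0 => []
  | i + 1 =>
    if s.owner i = p then view s p i ++ [i]
    else if _h : s.ptr i < i then view s p (s.ptr i) ++ [s.ptr i, i]
    else [i]
termination_by n => n
decreasing_by all_goals omega

/-- A visible play: every move other than the first points into the view that its owner has of the
initial segment preceding the move. -/
def IsVisiblePlay (s : JustifiedSeq A) : Prop :=
  s.IsPlay ∧ ∀ i, 0 < i → i ≤ s.last → s.ptr i ∈ s.view (s.owner i) i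

/-- The edge `(s_{ptr i}, s_i)` from `s_i` is crossed by the edge `(s_{ptr j}, s_j)` from `s_j`. -/
def CrossedBy (s : JustifiedSeq A) (i j : ℕ) : Prop :=
  0 < i ∧ 0 < j ∧ s.ptr i < s.ptr j ∧ s.ptr j < i ∧ i < j

/-- For `i ≤ n`: the edge from `s_i` is active in `s₀ … s_n`, by backward recursion on `i`. An edge
is inactive if it is not active. -/
def Active (s : JustifiedSeq A) (n i : ℕ) : Prop :=
  ∀ j, i < j → j ≤ n → s.CrossedBy i j → ¬ Active s n j
termination_by n - i
decreasing_by omega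

/-- The edge from `s_i` is inactivated by the edge from `s_j`: it is crossed by it, and active in
`s₀ … s_{j-1}`. -/
def InactivatedBy (s : JustifiedSeq A) (i j : ℕ) : Prop :=
  s.CrossedBy i j ∧ s.Active (j - 1) i

/-- The lengths `k` of the chains `e₁, …, e_k` of edges such that each of `e₁, …, e_k` is inactivated
by the next one and `e_k` is inactivated by the edge from `s_i`. An edge is given by the position
of the move it starts from. -/
def chainLengths (s : JustifiedSeq A) (i : ℕ) : Set ℕ :=
  {k | ∃ c : List ℕ, c.length = k ∧ List.IsChain s.InactivatedBy (c ++ [i])}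

/-- The set of lengths of chains is nonempty (it contains `0`) and bounded, so that the longest
chain below exists. -/
theorem chainLengths_nonempty_bddAbove (s : JustifiedSeq A) (i : ℕ) :
    (s.chainLengths i).Nonempty ∧ BddAbove (s.chainLengths i) := by
  refine ⟨⟨0, [], rfl, by simp⟩, i + 1, ?_⟩
  rintro k ⟨c, rfl, hc⟩
  have h1 : List.IsChain (· < ·) (c ++ [i]) := hc.imp fun _ _ h => h.1.2.2.2.2
  have h2 : (c ++ [i]).SortedLT := h1.sortedLT
  have hp := h2.pairwise
  rw [List.pairwise_append] at hp
  have h3 : c ⊆ List.range i := fun a ha => List.mem_range.2 (hp.2.2 a ha i (by simp))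
  have h4 : c.Nodup := hp.1.imp fun h => ne_of_lt h
  have h5 := (h4.subperm h3).length_le
  simp at h5
  omega

open scoped Classical in
/-- The backtracking level of the move `s_i` in `s`. -/
noncomputable def moveLevel (s : JustifiedSeq A) (i : ℕ) : ℕ :=
  if i = 0 ∨ s.ptr i + 1 = i then 0 else sSup (s.chainLengths i) + 1

/-- The backtracking level of the player `p` in `s`: the maximal level of a move of `p` (and `0` if
`p` has no move in `s`). -/
noncomputable def playerLevel (s : JustifiedSeq A) (p : Player) : ℕ :=
  ((Finset.range (s.last + 1)).filter fun i => s.owner i = p).sup s.moveLevel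

/-- The real backtracking level of `s`. -/
noncomputable def realLevel (s : JustifiedSeq A) : ℕ :=
  min (s.playerLevel Player.P) (s.playerLevel Player.O)

/-- The principal player of `s`. -/
noncomputable def principal (s : JustifiedSeq A) : Player :=
  if s.realLevel = s.playerLevel Player.P then Player.P else Player.O

/-- The lengths of the `p`-views and of the `p̄`-views of the initial segments `s₀ … s_i`,
`0 ≤ i ≤ last`. -/
def viewLengths (s : JustifiedSeq A) (p : Player) : Set ℕ :=
  {n | ∃ i, i ≤ s.last ∧
    (n = (s.view p (i + 1)).length ∨ n = (s.view p.other (i + 1)).length)}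

end JustifiedSeq

/-- The hyperexponential function `a_n^m`: `a_0^m = m` and `a_{n+1}^m = a ^ (a_n^m)`. In particular
`hyperexp a n a` is the tower `a ^ a ^ ⋯ ^ a` with `n + 1` occurrences of `a`. -/
noncomputable def hyperexp (a : ℝ) : ℕ → ℝ → ℝ
  | 0, m => m
  | n + 1, m => a ^ hyperexp a n m

/-! The proof trades the backtracking level of the principal player `p` for the length of the
adversary's views. Redirect every level-one move of `p` to the preceding move (`lower`). Level-one
edges inactivate nothing, so the activity of the other edges is unaffected (`lower_active`), every
chain of inactivations loses its first edge, and the level of `p` drops by one (`LevelLE.lower`).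
The `p`-views do not change, since they follow only pointers of the adversary. The adversary's views
can only grow (`view_subset_lower_view`), so the play stays visible.

The growth is bounded by `length_lower_view_le`: a lowered view of the adversary, ordered by the old
view predecessor, is a tree of depth at most `N`, the old bound on these views. Each node has fewer
than `k` children, because the moves of `p` in it with a common target all lie in one `p`-view
(`card_pointing_lt`). Hence `N` becomes at most `k ^ N`. At level zero the adversary's view is the
whole play, so `b` lowerings starting from `N = k` give the tower.

Behind all this is one fact on visible plays: the adversary edges along which a view jumps are
active (`active_of_mem_view`). -/

theorem Player.eq_of_ne_of_ne {a b c : Player} (h : a ≠ c) (h' : b ≠ c) : a = b := by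
  cases a <;> cases b <;> cases c <;> simp_all

theorem Player.other_ne (p : Player) : p.other ≠ p := by
  cases p <;> simp [Player.other]

theorem Player.ne_other_iff {a p : Player} : a ≠ p.other ↔ a = p := by
  cases a <;> cases p <;> simp [Player.other]

/-! ### Views as chains of predecessors -/

namespace JustifiedSeq

variable {A : Arena}

theorem owner_ptr_ne (s : JustifiedSeq A) {i : ℕ} (h0 : 0 < i) (hi : i ≤ s.last) :
    s.owner (s.ptr i) ≠ s.owner i :=
  A.label_ne _ _ (s.enables_ptr i h0 hi)

/-- The position preceding the position `i` in the `q`-view ending at `i`. -/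
def viewPred (s : JustifiedSeq A) (q : Player) (i : ℕ) : ℕ :=
  if s.owner i = q then i - 1 else s.ptr i

theorem viewPred_lt (s : JustifiedSeq A) (q : Player) {i : ℕ} (h0 : 0 < i) (hi : i ≤ s.last) :
    s.viewPred q i < i := by
  unfold viewPred
  split_ifs
  · omega
  · exact s.ptr_lt i h0 hi

theorem view_one (s : JustifiedSeq A) (q : Player) : s.view q 1 = [0] := by
  rw [view]
  split_ifs <;> simp_all [view]

/-- If `s_i` is not a move of `q`, its target is one, so the two moves appended by the definition of
the view are two successive predecessor steps. -/
theorem view_succ (s : JustifiedSeq A) (q : Player) {i : ℕ} (h0 : 0 < i) (hi : i ≤ s.last) :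
    s.view q (i + 1) = s.view q (s.viewPred q i + 1) ++ [i] := by
  by_cases h : s.owner i = q
  · rw [view, if_pos h, viewPred, if_pos h, Nat.sub_add_cancel h0]
  · have hq : s.owner (s.ptr i) = q :=
      Player.eq_of_ne_of_ne (s.owner_ptr_ne h0 hi) (Ne.symm h)
    rw [view, if_neg h, dif_pos (s.ptr_lt i h0 hi), viewPred, if_neg h, view, if_pos hq]
    simp

theorem view_succ_of_owner_eq (s : JustifiedSeq A) {q : Player} {i : ℕ} (h : s.owner i = q) :
    s.view q (i + 1) = s.view q i ++ [i] := by
  rw [view, if_pos h]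

theorem view_succ_of_owner_ne (s : JustifiedSeq A) {q : Player} {i : ℕ} (h0 : 0 < i)
    (hi : i ≤ s.last) (h : s.owner i ≠ q) :
    s.view q (i + 1) = s.view q (s.ptr i + 1) ++ [i] := by
  rw [view_succ s q h0 hi, viewPred, if_neg h]

theorem view_induction (s : JustifiedSeq A) (q : Player) {motive : ℕ → Prop} (zero : motive 0)
    (one : motive 1)
    (succ : ∀ i, 0 < i → i ≤ s.last → motive (s.viewPred q i + 1) → motive (i + 1))
    {n : ℕ} (hn : n ≤ s.last + 1) : motive n := by
  induction n using Nat.strong_induction_on with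
  | _ n ih =>
    rcases n with _ | i
    · exact zero
    · rcases Nat.eq_zero_or_pos i with rfl | h0
      · exact one
      · have := s.viewPred_lt q h0 (by omega)
        exact succ i h0 (by omega) (ih _ (by omega) (by omega))

theorem lt_of_mem_view (s : JustifiedSeq A) {q : Player} {n x : ℕ} (hn : n ≤ s.last + 1)
    (hx : x ∈ s.view q n) : x < n := by
  revert x
  refine s.view_induction q (motive := fun n => ∀ {x}, x ∈ s.view q n → x < n) ?_ ?_ ?_ hn
  · simp [view]
  · simp [view_one]
  · intro i h0 hi ih x hx
    have := s.viewPred_lt q h0 hi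
    rw [view_succ s q h0 hi, List.mem_append, List.mem_singleton] at hx
    rcases hx with hx | rfl
    · have := ih hx; omega
    · omega

theorem nodup_view (s : JustifiedSeq A) (q : Player) {n : ℕ} (hn : n ≤ s.last + 1) :
    (s.view q n).Nodup := by
  refine s.view_induction q (motive := fun n => (s.view q n).Nodup) ?_ ?_ ?_ hn
  · simp [view]
  · simp [view_one]
  · intro i h0 hi ih
    have := s.viewPred_lt q h0 hi
    rw [view_succ s q h0 hi, List.nodup_append]
    refine ⟨ih, by simp, fun a ha b hb => ?_⟩
    have := s.lt_of_mem_view (by omega) ha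
    rw [List.mem_singleton] at hb
    omega

theorem self_mem_view (s : JustifiedSeq A) (q : Player) {i : ℕ} (hi : i ≤ s.last) :
    i ∈ s.view q (i + 1) := by
  rcases Nat.eq_zero_or_pos i with rfl | h0
  · simp [view_one]
  · simp [view_succ s q h0 hi]

theorem view_subset_of_mem (s : JustifiedSeq A) {q : Player} {n x : ℕ} (hn : n ≤ s.last + 1)
    (hx : x ∈ s.view q n) : s.view q (x + 1) ⊆ s.view q n := by
  revert x
  refine s.view_induction q
    (motive := fun n => ∀ {x}, x ∈ s.view q n → s.view q (x + 1) ⊆ s.view q n) ?_ ?_ ?_ hn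
  · simp [view]
  · simp [view_one]
  · intro i h0 hi ih x hx
    have hs := view_succ s q h0 hi
    rw [hs, List.mem_append, List.mem_singleton] at hx
    rcases hx with hx | rfl
    · rw [hs]
      exact List.subset_append_of_subset_left _ (ih hx)
    · exact List.Subset.refl _

theorem mem_view_succ_of_le (s : JustifiedSeq A) {q : Player} {n x y : ℕ} (hn : n ≤ s.last + 1)
    (hx : x ∈ s.view q n) (hy : y ∈ s.view q n) (hyx : y ≤ x) : y ∈ s.view q (x + 1) := by
  revert hx hy
  refine s.view_induction q
    (motive := fun n => x ∈ s.view q n → y ∈ s.view q n → y ∈ s.view q (x + 1)) ?_ ?_ ?_ hn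
  · simp [view]
  · simp only [view_one, List.mem_singleton]
    rintro rfl rfl
    simp [view_one]
  · intro i h0 hi ih hx hy
    have := s.viewPred_lt q h0 hi
    rw [view_succ s q h0 hi, List.mem_append, List.mem_singleton] at hx
    rcases hx with hx | rfl
    · have := s.lt_of_mem_view (by omega) hx
      rw [view_succ s q h0 hi, List.mem_append, List.mem_singleton] at hy
      exact ih hx (hy.resolve_right (by omega))
    · exact hy

/-- A view omits only what its adversary edges jump over; `not_jump_of_mem_view` is the converse. -/
theorem exists_jump_of_notMem_view (s : JustifiedSeq A) {q : Player} {n y : ℕ}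
    (hn : n ≤ s.last + 1) (hyn : y < n) (hy : y ∉ s.view q n) :
    ∃ g ∈ s.view q n, s.owner g ≠ q ∧ s.ptr g < y ∧ y < g := by
  revert hyn hy
  refine s.view_induction q (motive := fun n => y < n → y ∉ s.view q n →
    ∃ g ∈ s.view q n, s.owner g ≠ q ∧ s.ptr g < y ∧ y < g) ?_ ?_ ?_ hn
  · simp
  · intro h h'
    simp [view_one] at h'
    omega
  · intro i h0 hi ih hyn hy
    rw [view_succ s q h0 hi] at hy ⊢
    simp only [List.mem_append, List.mem_singleton, not_or] at hy ⊢
    by_cases h : y < s.viewPred q i + 1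
    · obtain ⟨g, hg, h'⟩ := ih h hy.1
      exact ⟨g, Or.inl hg, h'⟩
    · refine ⟨i, Or.inr rfl, ?_⟩
      unfold viewPred at h
      split_ifs at h with ho
      · omega
      · exact ⟨ho, by omega, by omega⟩

theorem not_jump_of_mem_view (s : JustifiedSeq A) {q : Player} {n g y : ℕ} (hn : n ≤ s.last + 1)
    (hg : g ∈ s.view q n) (ho : s.owner g ≠ q) (hy : y ∈ s.view q n) (h1 : s.ptr g < y)
    (h2 : y < g) : False := by
  have hgn := s.lt_of_mem_view hn hg
  have h := s.mem_view_succ_of_le hn hg hy h2.le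
  rw [view_succ_of_owner_ne s (by omega) (by omega) ho, List.mem_append, List.mem_singleton] at h
  rcases h with h | h
  · have := s.lt_of_mem_view (by omega) h; omega
  · omega

theorem mem_view_succ_of_mem (s : JustifiedSeq A) {q : Player} {i x : ℕ} (h : s.owner i = q)
    (hx : x ∈ s.view q i) : x ∈ s.view q (i + 1) := by
  rw [view_succ_of_owner_eq s h]
  exact List.mem_append_left _ hx

/-! ### Activity of edges -/

theorem active_iff (s : JustifiedSeq A) {n i : ℕ} :
    s.Active n i ↔ ∀ j, i < j → j ≤ n → s.CrossedBy i j → ¬ s.Active n j := by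
  rw [Active]

/-- All moves at positions less than `n` point into the view of their owner. -/
def VisibleBelow (s : JustifiedSeq A) (n : ℕ) : Prop :=
  ∀ i, 0 < i → i < n → s.ptr i ∈ s.view (s.owner i) i

theorem VisibleBelow.mono {s : JustifiedSeq A} {m n : ℕ} (h : s.VisibleBelow n) (hmn : m ≤ n) :
    s.VisibleBelow m := fun i h0 hi => h i h0 (by omega)

/-- Suppose an active edge `j` crosses `b`. If `j` is in the view, then `b` jumps over the target of
`j`, or `j` jumps over `b`, inside the view. Otherwise the view jumps over `j` along a later edge
`g`, which crosses `j` and is active by induction. -/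
theorem active_of_mem_view (s : JustifiedSeq A) {q : Player} {n : ℕ} (hn : n ≤ s.last + 1)
    (hv : s.VisibleBelow n) {b : ℕ} (hb : b ∈ s.view q n) (ho : s.owner b ≠ q) :
    s.Active (n - 1) b := by
  induction hm : n - b using Nat.strong_induction_on generalizing b with
  | _ d ih =>
    subst hm
    rw [active_iff]
    rintro j hbj hjn ⟨h0, h0', h1, h2, -⟩ hj
    by_cases hjv : j ∈ s.view q n
    · by_cases hjo : s.owner j = q
      · have h3 := hv j h0' (by omega)
        rw [hjo] at h3
        exact s.not_jump_of_mem_view hn hb ho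
          (s.view_subset_of_mem hn hjv (s.mem_view_succ_of_mem hjo h3)) h1 h2
      · exact s.not_jump_of_mem_view hn hjv hjo hb h2 hbj
    · obtain ⟨g, hg, hgo, hg1, hg2⟩ := s.exists_jump_of_notMem_view hn (by omega) hjv
      have hgn := s.lt_of_mem_view hn hg
      have hbg : b ≤ s.ptr g := by
        by_contra h
        exact s.not_jump_of_mem_view hn hg hgo hb (by omega) (by omega)
      exact active_iff s |>.1 hj g hg2 (by omega) ⟨h0', by omega, by omega, hg1, hg2⟩
        (ih (n - g) (by omega) hg hgo rfl)

/-- An edge of a player inactivates only edges of the same player. -/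
theorem InactivatedBy.owner_eq {s : JustifiedSeq A} {i j : ℕ} (h : s.InactivatedBy i j)
    (hj : j ≤ s.last) (hv : s.VisibleBelow (j + 1)) : s.owner i = s.owner j := by
  obtain ⟨⟨h0, h0', h1, h2, h3⟩, ha⟩ := h
  have hp := hv j h0' (by omega)
  by_contra ho
  by_cases hi : i ∈ s.view (s.owner j) j
  · exact s.not_jump_of_mem_view (by omega) hi ho hp h1 h2
  · obtain ⟨g, hg, hgo, hg1, hg2⟩ := s.exists_jump_of_notMem_view (by omega) h3 hi
    have hgn := s.lt_of_mem_view (by omega) hg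
    have hle : s.ptr j ≤ s.ptr g := by
      by_contra h
      exact s.not_jump_of_mem_view (by omega) hg hgo hp (by omega) (by omega)
    exact active_iff s |>.1 ha g hg2 (by omega) ⟨h0, by omega, by omega, hg1, hg2⟩
      (s.active_of_mem_view (by omega) (hv.mono (by omega)) hg hgo)

/-- As long as the edge from `s_e` is active, the activity of the edges it encloses is frozen. -/
theorem active_iff_of_enclosed (s : JustifiedSeq A) {e t f : ℕ} (he : s.Active t e) (het : e ≤ t)
    (h0 : 0 < f) (hfe : f < e) (hp : s.ptr e ≤ s.ptr f) :
    s.Active t f ↔ s.Active (e - 1) f := by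
  induction hm : e - f using Nat.strong_induction_on generalizing f with
  | _ d ih =>
    subst hm
    rw [active_iff, active_iff s (n := e - 1)]
    constructor
    · intro h j hfj hj hc
      rw [← ih (e - j) (by omega) (by omega) (by omega) (hp.trans hc.2.2.1.le) rfl]
      exact h j hfj (by omega) hc
    · intro h j hfj hj hc ha
      obtain ⟨-, h0', h1, h2, -⟩ := id hc
      rcases lt_trichotomy j e with hje | rfl | hje
      · rw [ih (e - j) (by omega) (by omega) (by omega) (by omega) rfl] at ha
        exact h j hfj (by omega) hc ha
      · omega
      -- An edge from beyond `e` that crosses `f` crosses `e` as well.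
      · exact active_iff s |>.1 he j hje hj ⟨by omega, h0', by omega, by omega, hje⟩ ha

/-- An active witness of inactivity can be chosen among the edges that really inactivate something.
If the crossing edge `e` found `i` already inactive, an earlier witness `f` exists; either `e`
inactivates `f`, or `e` encloses `f` and freezes its activity. -/
theorem exists_active_crossing (s : JustifiedSeq A) (C D : ℕ → Prop) (hDC : ∀ i, D i → C i)
    {N : ℕ} (hCD : ∀ i e, C i → e ≤ N → s.InactivatedBy i e → D e) {n i : ℕ} (hn : n ≤ N)
    (hi : C i) (ha : ¬ s.Active n i) : ∃ j, D j ∧ j ≤ n ∧ s.CrossedBy i j ∧ s.Active n j := by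
  induction n using Nat.strong_induction_on with
  | _ n ih =>
    rw [active_iff] at ha
    push Not at ha
    obtain ⟨e, hie, hen, hc, hea⟩ := ha
    by_cases hai : s.Active (e - 1) i
    · exact ⟨e, hCD i e hi (by omega) ⟨hc, hai⟩, hen, hc, hea⟩
    · obtain ⟨f, hf, hfe, hcf, hfa⟩ := ih (e - 1) (by omega) (by omega) hai
      obtain ⟨h0, h0f, h1, h2, h3⟩ := id hcf
      have := hc.2.1
      by_cases hx : s.CrossedBy f e
      · exact ⟨e, hCD f e (hDC f hf) (by omega) ⟨hx, hfa⟩, hen, hc, hea⟩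
      · refine ⟨f, hf, by omega, hcf,
          (s.active_iff_of_enclosed hea hen h0f (by omega) ?_).2 hfa⟩
        by_contra h
        exact hx ⟨h0f, hc.2.1, by omega, by have := hc.2.2.2.1; omega, by omega⟩

end JustifiedSeq

/-! ### Lowering the level-one moves -/

/-- The arena in which every move enables all the moves of the other player. -/
def Arena.loose (A : Arena) : Arena where
  Move := A.Move
  enables m n := A.label m ≠ A.label n
  label := A.label
  label_ne _ _ h := h
  init := A.init
  label_init := A.label_init
  star := A.star
  star_mem := A.star_mem

namespace JustifiedSeq

variable {A : Arena}

/-- The moves of `p` of backtracking level one: they do not point to the preceding move, and their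
edge inactivates no edge. -/
def LevelOne (s : JustifiedSeq A) (p : Player) (j : ℕ) : Prop :=
  0 < j ∧ s.owner j = p ∧ s.ptr j + 1 ≠ j ∧ ∀ i, ¬ s.InactivatedBy i j

open scoped Classical in
/-- The play obtained by letting all moves of `p` of level one point to the preceding move. -/
noncomputable def lower (s : JustifiedSeq A) (p : Player) (h : s.IsPlay) :
    JustifiedSeq A.loose where
  last := s.last
  move := s.move
  ptr i := if s.LevelOne p i then i - 1 else s.ptr i
  move_zero := s.move_zero
  ptr_lt i h0 hi := by
    split_ifs
    · omega
    · exact s.ptr_lt i h0 hi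
  enables_ptr i h0 hi := by
    split_ifs
    -- The redirected pointer may violate the original enabling relation; the loose arena asks only
    -- for alternation.
    · have := h (i - 1) (by omega)
      rwa [Nat.sub_add_cancel h0] at this
    · exact s.owner_ptr_ne h0 hi

section lower

variable {s : JustifiedSeq A} {p : Player} {h : s.IsPlay}

theorem lower_last : (s.lower p h).last = s.last := rfl

theorem lower_owner (i : ℕ) : (s.lower p h).owner i = s.owner i := rfl

theorem lower_ptr_of_levelOne {i : ℕ} (hi : s.LevelOne p i) : (s.lower p h).ptr i = i - 1 :=
  if_pos hi

theorem lower_ptr_of_not_levelOne {i : ℕ} (hi : ¬ s.LevelOne p i) :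
    (s.lower p h).ptr i = s.ptr i :=
  if_neg hi

theorem lower_ptr_of_lt {i y : ℕ} (h1 : (s.lower p h).ptr i < y) (h2 : y < i) :
    ¬ s.LevelOne p i ∧ s.ptr i < y := by
  by_cases hi : s.LevelOne p i
  · rw [lower_ptr_of_levelOne hi] at h1; omega
  · rw [lower_ptr_of_not_levelOne hi] at h1
    exact ⟨hi, h1⟩

theorem lower_crossedBy {i j : ℕ} :
    (s.lower p h).CrossedBy i j ↔ s.CrossedBy i j ∧ ¬ s.LevelOne p i ∧ ¬ s.LevelOne p j := by
  constructor
  · rintro ⟨h0, h0', h1, h2, h3⟩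
    obtain ⟨hj, hj'⟩ := lower_ptr_of_lt h2 h3
    rw [lower_ptr_of_not_levelOne hj] at h1
    obtain ⟨hi, hi'⟩ := lower_ptr_of_lt h1 hj'
    exact ⟨⟨h0, h0', hi', hj', h3⟩, hi, hj⟩
  · rintro ⟨⟨h0, h0', h1, h2, h3⟩, hi, hj⟩
    refine ⟨h0, h0', ?_, ?_, h3⟩
    · rwa [lower_ptr_of_not_levelOne hi, lower_ptr_of_not_levelOne hj]
    · rwa [lower_ptr_of_not_levelOne hj]

theorem lower_active {n i : ℕ} (hi : ¬ s.LevelOne p i) :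
    (s.lower p h).Active n i ↔ s.Active n i := by
  induction hm : n - i using Nat.strong_induction_on generalizing i with
  | _ d ih =>
    subst hm
    constructor
    · intro ha
      by_contra hna
      obtain ⟨j, hj, hjn, hc, hja⟩ := s.exists_active_crossing (fun _ => True)
        (fun j => ¬ s.LevelOne p j) (fun _ _ => trivial) (N := n)
        (fun i e _ _ hie he => he.2.2.2 i hie) le_rfl trivial hna
      have hij : i < j := hc.2.2.2.2
      exact active_iff _ |>.1 ha j hij hjn (lower_crossedBy.2 ⟨hc, hi, hj⟩)
        ((ih (n - j) (by omega) hj rfl).2 hja)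
    · intro ha
      rw [active_iff]
      intro j hij hjn hc hja
      obtain ⟨hc, -, hj⟩ := lower_crossedBy.1 hc
      exact active_iff _ |>.1 ha j hij hjn hc ((ih (n - j) (by omega) hj rfl).1 hja)

theorem lower_inactivatedBy {i j : ℕ} (hij : (s.lower p h).InactivatedBy i j) :
    s.InactivatedBy i j ∧ ¬ s.LevelOne p i ∧ ¬ s.LevelOne p j := by
  obtain ⟨hc, hi, hj⟩ := lower_crossedBy.1 hij.1
  exact ⟨⟨hc, (lower_active hi).1 hij.2⟩, hi, hj⟩

/-! ### Views and visibility of the lowered play -/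

theorem lower_view_self {n : ℕ} (hn : n ≤ s.last + 1) : (s.lower p h).view p n = s.view p n := by
  refine s.view_induction p (motive := fun n => (s.lower p h).view p n = s.view p n) ?_ ?_ ?_ hn
  · simp [view]
  · simp [view_one]
  · intro i h0 hi ih
    have hpred : (s.lower p h).viewPred p i = s.viewPred p i := by
      unfold viewPred
      rw [lower_owner]
      split_ifs with ho
      · rfl
      · exact lower_ptr_of_not_levelOne fun hl => ho hl.2.1
    rw [view_succ (s.lower p h) p h0 hi, view_succ s p h0 hi, hpred, ih]

/-- If the views of the adversary grow below `n`, the lowered play is visible below `n`. -/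
theorem lower_visibleBelow {n : ℕ} (hn : n ≤ s.last + 1) (hv : s.VisibleBelow n)
    (hs : ∀ m < n, s.view p.other m ⊆ (s.lower p h).view p.other m) :
    (s.lower p h).VisibleBelow n := by
  intro j h0 hj
  rw [lower_owner]
  by_cases ho : s.owner j = p
  · rw [ho, lower_view_self (by omega)]
    by_cases hl : s.LevelOne p j
    · rw [lower_ptr_of_levelOne hl]
      have := s.self_mem_view p (i := j - 1) (by omega)
      rwa [Nat.sub_add_cancel h0] at this
    · rw [lower_ptr_of_not_levelOne hl, ← ho]
      exact hv j h0 hj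
  · have ho' : s.owner j = p.other := Player.eq_of_ne_of_ne ho (Player.other_ne p)
    rw [ho', lower_ptr_of_not_levelOne fun hl => ho hl.2.1]
    have := hv j h0 hj
    rw [ho'] at this
    exact hs j hj this

/-- Only a redirected move `i` could lose part of its view. If its old target were missing, the
lowered view would jump over it along an active edge `g` of `p`, and `i` would inactivate `g`,
contrary to level one. -/
theorem view_subset_lower_view {n : ℕ} (hn : n ≤ s.last + 1) (hv : s.VisibleBelow n) :
    s.view p.other n ⊆ (s.lower p h).view p.other n := by
  induction n using Nat.strong_induction_on with
  | _ n ih =>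
    rcases n with _ | i
    · simp [view]
    rcases Nat.eq_zero_or_pos i with rfl | h0
    · simp [view_one]
    by_cases ho : s.owner i = p
    · have hne : s.owner i ≠ p.other := Player.ne_other_iff.2 ho
      have hlt := s.ptr_lt i h0 (by omega)
      rw [view_succ_of_owner_ne s h0 (by omega) hne]
      have ihp := ih (s.ptr i + 1) (by omega) (by omega) (hv.mono (by omega))
      by_cases hl : s.LevelOne p i
      · rw [view_succ_of_owner_ne (s.lower p h) h0 (by rw [lower_last]; omega) hne,
          lower_ptr_of_levelOne hl, Nat.sub_add_cancel h0]
        suffices hm : s.ptr i ∈ (s.lower p h).view p.other i by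
          intro x hx
          rw [List.mem_append] at hx ⊢
          refine hx.imp_left fun hx => ?_
          exact view_subset_of_mem (s.lower p h) (by rw [lower_last]; omega) hm (ihp hx)
        by_contra hm
        obtain ⟨g, hg, hgo, hg1, hg2⟩ := exists_jump_of_notMem_view (s.lower p h)
          (by rw [lower_last]; omega) hlt hm
        have hgi := lt_of_mem_view (s.lower p h) (by rw [lower_last]; omega) hg
        obtain ⟨hgl, hg1'⟩ := lower_ptr_of_lt hg1 hg2
        have hga := active_of_mem_view (s.lower p h) (by rw [lower_last]; omega)
          (lower_visibleBelow (by omega) (hv.mono (by omega))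
            fun m hmi => ih m (by omega) (by omega) (hv.mono (by omega))) hg hgo
        exact hl.2.2.2 g ⟨⟨by omega, h0, hg1', hg2, hgi⟩, (lower_active hgl).1 hga⟩
      · rw [view_succ_of_owner_ne (s.lower p h) h0 (by rw [lower_last]; omega) hne,
          lower_ptr_of_not_levelOne hl]
        intro x hx
        rw [List.mem_append] at hx ⊢
        exact hx.imp_left fun hx => ihp hx
    · have ho' : s.owner i = p.other := Player.eq_of_ne_of_ne ho (Player.other_ne p)
      rw [view_succ_of_owner_eq s ho', view_succ_of_owner_eq (s.lower p h) ho']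
      intro x hx
      rw [List.mem_append] at hx ⊢
      exact hx.imp_left fun hx => ih i (by omega) (by omega) (hv.mono (by omega)) hx

theorem VisibleBelow.lower {n : ℕ} (hn : n ≤ s.last + 1) (hv : s.VisibleBelow n) :
    (s.lower p h).VisibleBelow n :=
  lower_visibleBelow hn hv fun _ hm => view_subset_lower_view (by omega) (hv.mono hm.le)

/-- The edges of `p` in the lowered view of its adversary are active. -/
theorem active_of_mem_lower_view {n : ℕ} (hn : n ≤ s.last + 1) (hv : s.VisibleBelow n) {x : ℕ}
    (hx : x ∈ (s.lower p h).view p.other n) (ho : s.owner x = p) : s.Active (n - 1) x := by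
  by_contra hna
  -- The edge of `x` may itself be redirected, so activity cannot be read off the lowered play; the
  -- crossing edge `f` is chosen to survive the lowering.
  obtain ⟨f, ⟨hfl, hfo⟩, hfn, hc, hfa⟩ := s.exists_active_crossing (fun i => s.owner i = p)
    (fun j => ¬ s.LevelOne p j ∧ s.owner j = p) (fun _ h => h.2) (N := n - 1)
    (fun i e hi he hie => ⟨fun hl => hl.2.2.2 i hie, by
      rw [← hie.owner_eq (by omega) (hv.mono (by have := hie.1.2.1; omega))]; exact hi⟩)
    le_rfl ho hna
  obtain ⟨h0, h0', h1, h2, h3⟩ := hc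
  by_cases hf : f ∈ (s.lower p h).view p.other n
  · exact not_jump_of_mem_view (s.lower p h) hn hf (Player.ne_other_iff.2 hfo) hx
      (by rwa [lower_ptr_of_not_levelOne hfl]) h3
  · obtain ⟨g, hg, hgo, hg1, hg2⟩ := exists_jump_of_notMem_view (s.lower p h) hn (by omega) hf
    have hgn := lt_of_mem_view (s.lower p h) hn hg
    have hxg : x ≤ (s.lower p h).ptr g := by
      by_contra hlt
      exact not_jump_of_mem_view (s.lower p h) hn hg hgo hx (by omega) (by omega)
    obtain ⟨hgl, hg1'⟩ := lower_ptr_of_lt hg1 hg2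
    rw [lower_ptr_of_not_levelOne hgl] at hxg
    exact active_iff s |>.1 hfa g hg2 (by omega) ⟨h0', by omega, by omega, hg1', hg2⟩
      ((lower_active hgl).1 (active_of_mem_view (s.lower p h) hn (hv.lower hn) hg hgo))

/-! ### Growth of the adversary's views -/

/-- In a lowered view of the adversary of `p`, few moves of `p` point to the same move. -/
theorem card_pointing_lt {n k : ℕ} (hn : n ≤ s.last + 1) (hv : s.VisibleBelow n)
    (hk : ∀ i ≤ s.last, (s.view p (i + 1)).length ≤ k) (hk0 : 0 < k) (m : ℕ) :
    (((s.lower p h).view p.other n).toFinset.filter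
      fun j => 0 < j ∧ s.owner j = p ∧ s.ptr j = m).card < k := by
  set C := ((s.lower p h).view p.other n).toFinset.filter
      fun j => 0 < j ∧ s.owner j = p ∧ s.ptr j = m with hC
  have memC : ∀ j, j ∈ C ↔ j ∈ (s.lower p h).view p.other n ∧ 0 < j ∧ s.owner j = p ∧
      s.ptr j = m := by
    intro j
    simp [hC]
  rcases C.eq_empty_or_nonempty with he | hne
  · rw [he]; simpa using hk0
  obtain ⟨J, hJC, hJmax⟩ : ∃ J ∈ C, ∀ j ∈ C, j ≤ J :=
    ⟨C.max' hne, C.max'_mem hne, fun j hj => C.le_max' j hj⟩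
  obtain ⟨hJv, hJ0, hJo, hJm⟩ := (memC J).1 hJC
  have hJn := lt_of_mem_view (s.lower p h) hn hJv
  have hmJ : m < J := hJm ▸ s.ptr_lt J hJ0 (by omega)
  have hmview : m ∈ s.view p J := by
    have := hv J hJ0 hJn
    rwa [hJo, hJm] at this
  have hom : s.owner m ≠ p := by
    have := s.owner_ptr_ne hJ0 (by omega)
    rwa [hJm, hJo] at this
  -- The counted moves all lie in the `p`-view of the last one, `J`. So does their common target
  -- `m`, which is not a move of `p`; this makes the bound strict.
  have hsub : insert m C ⊆ (s.view p (J + 1)).toFinset := by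
    intro j hj
    rw [List.mem_toFinset]
    rcases Finset.mem_insert.1 hj with rfl | hj
    · exact s.mem_view_succ_of_mem hJo hmview
    rcases (hJmax j hj).eq_or_lt with rfl | hjJ
    · exact s.self_mem_view p (by omega)
    obtain ⟨hjv, hj0, hjo, hjm⟩ := (memC j).1 hj
    have hmj : m < j := hjm ▸ s.ptr_lt j hj0 (by omega)
    by_contra hjn
    have hjn' : j ∉ s.view p J := fun hx => hjn (s.mem_view_succ_of_mem hJo hx)
    -- A missing `j` is jumped over by an adversary edge `b`, whose target lies after `m`; so `b`
    -- crosses the edge of `j`, though both are active before `J`.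
    obtain ⟨b, hb, hbo, hb1, hb2⟩ := s.exists_jump_of_notMem_view (by omega) hjJ hjn'
    have hbJ := s.lt_of_mem_view (by omega) hb
    have hmb : m ≤ s.ptr b := by
      by_contra hlt
      exact s.not_jump_of_mem_view (by omega) hb hbo hmview (by omega) (by omega)
    have hmb' : m ≠ s.ptr b := by
      rintro rfl
      exact s.owner_ptr_ne (by omega) (by omega) (Player.eq_of_ne_of_ne
        (c := p) hom hbo)
    have hba := s.active_of_mem_view (by omega) (hv.mono hJn.le) hb hbo
    have hjJ' : j ∈ (s.lower p h).view p.other J := by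
      have hx := mem_view_succ_of_le (s.lower p h) hn hJv hjv hjJ.le
      by_cases hl : s.LevelOne p J
      · rw [view_succ_of_owner_ne (s.lower p h) hJ0 (by rw [lower_last]; omega)
          (Player.ne_other_iff.2 hJo), lower_ptr_of_levelOne hl, Nat.sub_add_cancel hJ0,
          List.mem_append, List.mem_singleton] at hx
        exact hx.resolve_right (by omega)
      · exact (not_jump_of_mem_view (s.lower p h) hn hJv (Player.ne_other_iff.2 hJo) hjv
          (by rw [lower_ptr_of_not_levelOne hl]; omega) hjJ).elim
    exact active_iff s |>.1 (active_of_mem_lower_view (by omega) (hv.mono hJn.le) hjJ' hjo) b hb2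
      (by omega) ⟨hj0, by omega, by omega, hb1, hb2⟩ hba
  have hmC : m ∉ C := fun hm => hom ((memC m).1 hm).2.2.1
  have h1 := Finset.card_le_card hsub
  rw [Finset.card_insert_of_notMem hmC] at h1
  have h2 := List.toFinset_card_le (s.view p (J + 1))
  have h3 := hk J (by omega)
  omega

/-- The lowered view contains the old view of each of its elements, so it is a tree rooted at `0`
under `s.viewPred p.other`, with old view length as depth. Counting by depth uses `1 + (k - 1) * k ^
d ≤ k ^ (d + 1)`. -/
theorem length_lower_view_le {n k N : ℕ} (hn : n ≤ s.last + 1) (hv : s.VisibleBelow n)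
    (hk : ∀ i ≤ s.last, (s.view p (i + 1)).length ≤ k) (hk2 : 2 ≤ k)
    (hN : ∀ i ≤ s.last, (s.view p.other (i + 1)).length ≤ N) :
    ((s.lower p h).view p.other n).length ≤ k ^ N := by
  set S := ((s.lower p h).view p.other n).toFinset with hS
  have key : ∀ d, (S.filter fun x => (s.view p.other (x + 1)).length ≤ d).card ≤ k ^ d := by
    intro d
    induction d with
    | zero =>
      refine (Finset.card_eq_zero.2 (Finset.filter_eq_empty_iff.2 ?_)).le.trans (Nat.zero_le _)
      intro x hx hl
      rw [hS, List.mem_toFinset] at hx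
      have := lt_of_mem_view (s.lower p h) hn hx
      have := List.length_pos_of_mem (s.self_mem_view p.other (i := x) (by omega))
      omega
    | succ d ih =>
      set T := S.filter fun x => (s.view p.other (x + 1)).length ≤ d with hT
      have hsub : (S.filter fun x => (s.view p.other (x + 1)).length ≤ d + 1) ⊆
          insert 0 (T.biUnion fun y => S.filter
            fun x => 0 < x ∧ s.viewPred p.other x = y) := by
        intro x hx
        rw [Finset.mem_filter, hS, List.mem_toFinset] at hx
        obtain ⟨hx, hl⟩ := hx
        rcases Nat.eq_zero_or_pos x with rfl | h0
        · exact Finset.mem_insert_self _ _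
        have hxn := lt_of_mem_view (s.lower p h) hn hx
        have hlt := s.viewPred_lt p.other h0 (by omega)
        have hxs := s.view_succ p.other h0 (by omega)
        refine Finset.mem_insert_of_mem (Finset.mem_biUnion.2 ⟨s.viewPred p.other x, ?_, ?_⟩)
        · rw [hT, Finset.mem_filter, hS, List.mem_toFinset]
          constructor
          · refine view_subset_of_mem (s.lower p h) hn hx
              (view_subset_lower_view (by omega) (hv.mono (by omega)) ?_)
            rw [hxs]
            exact List.mem_append_left _ (s.self_mem_view _ (by omega))
          · rw [hxs, List.length_append, List.length_singleton] at hl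
            omega
        · rw [Finset.mem_filter, hS, List.mem_toFinset]
          exact ⟨hx, h0, rfl⟩
      have hchild : ∀ y ∈ T, (S.filter
          fun x => 0 < x ∧ s.viewPred p.other x = y).card ≤ k - 1 := by
        intro y _
        -- A move of `p` can only be the predecessor of the next position; the children of an
        -- adversary move are moves of `p` pointing to it.
        by_cases hy : s.owner y = p
        · have : (S.filter fun x => 0 < x ∧ s.viewPred p.other x = y) ⊆ {y + 1} := by
            intro x hx
            rw [Finset.mem_filter, hS, List.mem_toFinset] at hx
            obtain ⟨hx, h0, hxy⟩ := hx
            have hxn := lt_of_mem_view (s.lower p h) hn hx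
            rw [Finset.mem_singleton]
            unfold viewPred at hxy
            split_ifs at hxy with hxo
            · omega
            · have := s.owner_ptr_ne h0 (by omega)
              rw [hxy, hy] at this
              exact (hxo (Player.eq_of_ne_of_ne this.symm (Player.other_ne p))).elim
          have := Finset.card_le_card this
          rw [Finset.card_singleton] at this
          omega
        · have : (S.filter fun x => 0 < x ∧ s.viewPred p.other x = y) ⊆
              S.filter fun j => 0 < j ∧ s.owner j = p ∧ s.ptr j = y := by
            intro x hx
            rw [Finset.mem_filter] at hx ⊢
            obtain ⟨hxS, h0, hxy⟩ := hx
            have hxn := lt_of_mem_view (s.lower p h) hn (List.mem_toFinset.1 hxS)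
            unfold viewPred at hxy
            split_ifs at hxy with hxo
            · have hpl := h (x - 1) (by omega)
              rw [Nat.sub_add_cancel h0, hxy, hxo] at hpl
              exact (hy (Player.ne_other_iff.1 hpl)).elim
            · exact ⟨hxS, h0, Player.eq_of_ne_of_ne hxo (Player.other_ne p).symm, hxy⟩
          have h1 := Finset.card_le_card this
          have h2 := card_pointing_lt (h := h) hn hv hk (by omega) y
          rw [← hS] at h2
          omega
      calc _ ≤ _ := Finset.card_le_card hsub
        _ ≤ _ := Finset.card_insert_le _ _
        _ ≤ T.card * (k - 1) + 1 :=
          Nat.add_le_add_right (Finset.card_biUnion_le_card_mul _ _ _ hchild) 1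
        _ ≤ k ^ d * (k - 1) + 1 := by gcongr
        _ ≤ k ^ (d + 1) := by
          obtain ⟨c, rfl⟩ : ∃ c, k = c + 1 := ⟨k - 1, by omega⟩
          have : 1 ≤ (c + 1) ^ d := Nat.one_le_pow _ _ (by omega)
          rw [pow_succ, Nat.add_sub_cancel]
          linarith [Nat.mul_add ((c + 1) ^ d) c 1]
  have h1 : S.card = ((s.lower p h).view p.other n).length :=
    List.toFinset_card_of_nodup (nodup_view (s.lower p h) _ hn)
  rw [← h1]
  refine le_trans (le_of_eq ?_) (key N)
  congr 1
  refine (Finset.filter_true_of_mem fun x hx => ?_).symm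
  have := lt_of_mem_view (s.lower p h) hn (List.mem_toFinset.1 hx)
  exact hN x (by omega)

end lower

/-! ### Descent of the level -/

/-- The backtracking level of `p` in `s` is at most `b`. -/
def LevelLE (s : JustifiedSeq A) (p : Player) (b : ℕ) : Prop :=
  ∀ i, 0 < i → i ≤ s.last → s.owner i = p → s.ptr i + 1 ≠ i →
    ∀ c : List ℕ, List.IsChain s.InactivatedBy (c ++ [i]) → c.length + 1 ≤ b

theorem levelLE_playerLevel (s : JustifiedSeq A) (p : Player) :
    s.LevelLE p (s.playerLevel p) := by
  intro i h0 hi ho hp c hc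
  have h1 : s.moveLevel i ≤ s.playerLevel p :=
    Finset.le_sup (f := s.moveLevel)
      (Finset.mem_filter.2 ⟨Finset.mem_range.2 (by omega), ho⟩)
  have h2 : c.length ≤ sSup (s.chainLengths i) :=
    le_csSup (s.chainLengths_nonempty_bddAbove i).2 ⟨c, rfl, hc⟩
  rw [moveLevel, if_neg (by omega)] at h1
  omega

theorem LevelLE.lower {s : JustifiedSeq A} {p : Player} {h : s.IsPlay} {b : ℕ}
    (hv : s.VisibleBelow (s.last + 1)) (hb : s.LevelLE p (b + 1)) : (s.lower p h).LevelLE p b := by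
  intro i h0 hi ho hp c hc
  have hil : ¬ s.LevelOne p i := fun hl => hp (by rw [lower_ptr_of_levelOne hl]; omega)
  rw [lower_ptr_of_not_levelOne hil] at hp
  have hc' : List.IsChain s.InactivatedBy (c ++ [i]) := hc.imp fun _ _ h => (lower_inactivatedBy h).1
  -- The first edge of the chain, or `i` itself if the chain is empty, is a move of `p` not of level
  -- one, so it inactivates some `x`, which extends the chain in `s`.
  obtain ⟨x, hx⟩ : ∃ x, List.IsChain s.InactivatedBy (x :: (c ++ [i])) := by
    rcases c with _ | ⟨e, c⟩
    · by_contra! hne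
      refine hil ⟨h0, ho, hp, fun x hx => hne x ?_⟩
      simpa using hx
    · have hmem : ∀ (l : List ℕ) (e : ℕ), List.IsChain s.InactivatedBy (e :: l ++ [i]) →
          s.owner e = p ∧ e ≤ s.last := by
        intro l
        induction l with
        | nil =>
          intro e he
          simp at he
          have := he.1.2.2.2.2
          exact ⟨(he.owner_eq hi (hv.mono (Nat.succ_le_succ hi))).trans ho, this.le.trans hi⟩
        | cons f l ih =>
          intro e he
          rw [List.cons_append, List.cons_append, List.isChain_cons_cons] at he
          obtain ⟨hfo, hfl⟩ := ih f he.2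
          have := he.1.1.2.2.2.2
          exact ⟨(he.1.owner_eq hfl (hv.mono (Nat.succ_le_succ hfl))).trans hfo,
            this.le.trans hfl⟩
      obtain ⟨heo, -⟩ := hmem c e hc'
      obtain ⟨f, hef⟩ : ∃ f, (s.lower p h).InactivatedBy e f := by
        rcases c with _ | ⟨f, c⟩
        · exact ⟨i, by simpa using hc⟩
        · rw [List.cons_append, List.cons_append, List.isChain_cons_cons] at hc
          exact ⟨f, hc.1⟩
      obtain ⟨⟨⟨he0, -, h1, h2, -⟩, -⟩, hel, -⟩ := lower_inactivatedBy hef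
      by_contra! hne
      refine hel ⟨he0, heo, by omega, fun x hx => hne x ?_⟩
      rw [List.cons_append, List.isChain_cons_cons]
      exact ⟨hx, hc'⟩
  have := hb i h0 hi ho hp (x :: c) hx
  simp only [List.length_cons] at this
  omega

theorem lower_isPlay {s : JustifiedSeq A} {p : Player} {h : s.IsPlay} : (s.lower p h).IsPlay := h

/-- If the level of `p` is zero, the views of its adversary are total. -/
theorem length_view_other_of_levelLE_zero {s : JustifiedSeq A} {p : Player} (hb : s.LevelLE p 0)
    {n : ℕ} (hn : n ≤ s.last + 1) : (s.view p.other n).length = n := by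
  induction n with
  | zero => simp [view]
  | succ i ih =>
    rcases Nat.eq_zero_or_pos i with rfl | h0
    · simp [view_one]
    have hpred : s.viewPred p.other i + 1 = i := by
      unfold viewPred
      split_ifs with ho
      · omega
      · by_contra hp
        have := hb i h0 (by omega) (Player.eq_of_ne_of_ne ho (Player.other_ne p).symm) hp []
          (by simp)
        omega
    rw [view_succ s _ h0 (by omega), hpred, List.length_append, ih (by omega),
      List.length_singleton]

end JustifiedSeq

/-! ### Towers and the final bound -/

/-- The tower `k ^ k ^ ⋯ ^ n` with `b` occurrences of `k`. -/
def natHyperexp (k : ℕ) : ℕ → ℕ → ℕ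
  | 0, n => n
  | b + 1, n => k ^ natHyperexp k b n

theorem natHyperexp_pow (k b n : ℕ) : natHyperexp k b (k ^ n) = natHyperexp k (b + 1) n := by
  induction b with
  | zero => rfl
  | succ b ih => rw [natHyperexp, ih]; rfl

theorem cast_natHyperexp (k b n : ℕ) : (natHyperexp k b n : ℝ) = hyperexp k b n := by
  induction b with
  | zero => rfl
  | succ b ih => rw [natHyperexp, hyperexp, ← ih, Nat.cast_pow, Real.rpow_natCast]

/-- Each lowering replaces `N` by `k ^ N` and keeps `k`. The induction runs over all arenas, since
lowering changes the arena. -/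
theorem JustifiedSeq.last_lt_natHyperexp {A : Arena} (s : JustifiedSeq A) (hp : s.IsPlay)
    (hv : s.VisibleBelow (s.last + 1)) {p : Player} {b k N : ℕ} (hb : s.LevelLE p b)
    (hk : ∀ i ≤ s.last, (s.view p (i + 1)).length ≤ k) (hk2 : 2 ≤ k)
    (hN : ∀ i ≤ s.last, (s.view p.other (i + 1)).length ≤ N) :
    s.last < natHyperexp k b N := by
  induction b generalizing A N with
  | zero =>
    have := hN s.last le_rfl
    rw [length_view_other_of_levelLE_zero hb le_rfl] at this
    exact this
  | succ b ih =>
    rw [← natHyperexp_pow]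
    refine ih (s.lower p hp) lower_isPlay (hv.lower le_rfl) (hb.lower hv) ?_ ?_
    · intro i hi
      rw [lower_view_self (s := s) (Nat.succ_le_succ hi)]
      exact hk i hi
    · intro i hi
      exact length_lower_view_le (Nat.succ_le_succ hi) (hv.mono (Nat.succ_le_succ hi)) hk hk2 hN

theorem hyperexp_two_nonneg (b : ℕ) {m : ℝ} (hm : 0 ≤ m) : 0 ≤ hyperexp 2 b m := by
  cases b with
  | zero => exact hm
  | succ b => exact Real.rpow_nonneg (by norm_num) _

theorem le_hyperexp_self {k : ℝ} (hk : 1 ≤ k) (b : ℕ) : k ≤ hyperexp k b k := by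
  induction b with
  | zero => exact le_rfl
  | succ b ih =>
    calc k = k ^ (1 : ℝ) := (Real.rpow_one k).symm
      _ ≤ k ^ hyperexp k b k := Real.rpow_le_rpow_of_exponent_le hk (hk.trans ih)

/-- The factor `2 * Real.logb 2 k` makes the induction close: with `L` the logarithm and `K` the
tower, `k ^ K = 2 ^ (L * K)`, and `2 * L` is absorbed by a second such power. -/
theorem hyperexp_self_le {k : ℝ} (hk : 2 ≤ k) (b : ℕ) :
    2 * (Real.logb 2 k * hyperexp k b k) ≤ hyperexp 2 b (2 * (k * Real.logb 2 k)) := by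
  have hL : 1 ≤ Real.logb 2 k := by
    rw [Real.le_logb_iff_rpow_le (by norm_num) (by linarith)]
    simpa using hk
  induction b with
  | zero => simp only [hyperexp]; linarith
  | succ b ih =>
    have hk2 : 2 ≤ hyperexp k b k := hk.trans (le_hyperexp_self (by linarith) b)
    set L := Real.logb 2 k with hLdef
    set K := hyperexp k b k
    have hkL : (2 : ℝ) ^ L = k := Real.rpow_logb (by norm_num) (by norm_num) (by linarith)
    have hLlt : 2 * L ≤ 2 ^ (L * K) := by
      have h1 : L + 1 ≤ 2 ^ L := by
        have := one_add_mul_self_le_rpow_one_add (s := (1 : ℝ)) (by norm_num) hL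
        norm_num at this
        linarith
      calc 2 * L ≤ (2 ^ L) ^ (2 : ℕ) := by nlinarith
        _ = 2 ^ (L * 2) := by rw [← Real.rpow_mul_natCast (by norm_num)]; norm_num
        _ ≤ 2 ^ (L * K) := Real.rpow_le_rpow_of_exponent_le (by norm_num) (by nlinarith)
    calc 2 * (L * k ^ K) = 2 * L * 2 ^ (L * K) := by
          rw [Real.rpow_mul (by norm_num), hkL]; ring
      _ ≤ 2 ^ (L * K) * 2 ^ (L * K) := by gcongr
      _ = 2 ^ (2 * (L * K)) := by rw [← Real.rpow_add (by norm_num)]; ring_nf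
      _ ≤ 2 ^ hyperexp 2 b (2 * (k * L)) := Real.rpow_le_rpow_of_exponent_le (by norm_num) ih

theorem mainTheorem2 (A : Arena) (s : JustifiedSeq A) (hs : s.IsVisiblePlay)
    (b : ℕ) (hb : b = s.realLevel) (p : Player) (hp : p = s.principal)
    (k : ℕ) (hk : IsGreatest (s.viewLengths p) k) :
    (s.last : ℝ) ≤ hyperexp k b k ∧
    (1 ≤ s.last → hyperexp k b k ≤ hyperexp 2 b (2 * (k * Real.logb 2 k))) ∧
    (s.last : ℝ) ≤ hyperexp 2 b (2 * (k * Real.logb 2 k)) := by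
  have hlevel : s.LevelLE p b := by
    have : s.playerLevel p = b := by
      rw [hb, hp, JustifiedSeq.principal]
      split_ifs with h
      · exact h.symm
      · have h' : s.realLevel = min (s.playerLevel Player.P) (s.playerLevel Player.O) := rfl
        omega
    exact this ▸ s.levelLE_playerLevel p
  have hk1 : ∀ i ≤ s.last, (s.view p (i + 1)).length ≤ k := fun i hi => hk.2 ⟨i, hi, Or.inl rfl⟩
  have hk2 : ∀ i ≤ s.last, (s.view p.other (i + 1)).length ≤ k :=
    fun i hi => hk.2 ⟨i, hi, Or.inr rfl⟩
  have hlog : 0 ≤ 2 * ((k : ℝ) * Real.logb 2 k) := by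
    have : 0 ≤ Real.logb 2 k := by
      rw [Real.logb]
      exact div_nonneg (Real.log_natCast_nonneg k) (Real.log_nonneg (by norm_num))
    positivity
  -- A single move has `k = 1`, where the comparison of the two towers fails.
  rcases Nat.eq_zero_or_pos s.last with h0 | hpos
  · rw [h0, Nat.cast_zero, ← cast_natHyperexp]
    exact ⟨Nat.cast_nonneg _, by omega, hyperexp_two_nonneg b hlog⟩
  · have h2k : 2 ≤ k := by
      refine le_trans ?_ (hk1 1 hpos)
      rw [s.view_succ p one_pos hpos, List.length_append, List.length_singleton]
      have hlt := s.viewPred_lt p one_pos hpos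
      have := List.length_pos_of_mem (s.self_mem_view p (i := s.viewPred p 1) (by omega))
      omega
    have hlast : (s.last : ℝ) ≤ hyperexp k b k := by
      rw [← cast_natHyperexp, Nat.cast_le]
      exact (s.last_lt_natHyperexp hs.1 (fun i hi hi' => hs.2 i hi (by omega)) hlevel hk1 h2k
        hk2).le
    have h2k' : (2 : ℝ) ≤ k := by exact_mod_cast h2k
    have hle : hyperexp k b k ≤ hyperexp 2 b (2 * (k * Real.logb 2 k)) := by
      refine le_trans ?_ (hyperexp_self_le h2k' b)
      have hL : 1 ≤ Real.logb 2 k := by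
        rw [Real.le_logb_iff_rpow_le (by norm_num) (by linarith)]
        simpa using h2k'
      have := le_hyperexp_self (k := (k : ℝ)) (by linarith) b
      nlinarith
    exact ⟨hlast, fun _ => hle, hlast.trans hle⟩
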